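/- Let $d\geq 1$ be an integer and let $\mathcal A=\mathbb R[x]_{\leq d}$ be the space of real univariate polynomials of degree at most $d$, regarded as functions on $\mathbb R$, with monomial basis $\mathsf A_{1,d}=\{1,x,\dots,x^d\}$. Consider either of the following two families of probability measures $\delta_{\sigma,\xi}$ on $\mathbb R$: (G) Gaussian: $\delta_{\sigma,\xi}$ is the normal distribution with mean $\xi\in\mathbb R$ and standard deviation $\sigma>0$; (L) log-normal: $\delta_{\sigma,\xi}$ is the distribution of $e^{Y}$, where $Y$ is normal with mean $\log \xi$, $\xi>0$, and standard deviation $\sigma>0$. A vector $s=(s_0,\dots,s_d)\in\mathbb R^{d+1}$ has a mixture representation with $k\in\mathbb N_0$ components if there are $c_1,\dots,c_k\geq 0$ and parameters $(\sigma_1,\xi_1),\dots,(\sigma_k,\xi_k)$ such that $$s_j=\int_{\mathbb R} x^j\,\mathrm d\Big(\sum_{i=1}^k c_i\,\delta_{\sigma_i,\xi_i}\Big)(x)\qquad\text{for } j=0,\dots,d .$$ Let $\mathcal T$ be the set of all $s$ that have a mixture representation with some finite number of components. For $s\in\mathcal T$ let $\mathcal C^M_{\mathsf A_{1,d}}(s)$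 be the smallest $k\in\mathbb N_0$ such that $s$ has a mixture representation with $k$ components, and let $\mathcal C^M_{\mathsf A_{1,d}}:=\max_{s\in\mathcal T}\mathcal C^M_{\mathsf A_{1,d}}(s)$ be the mixture Carathéodory number. Then, for the Gaussian family (G) as well as for the log-normal family (L), $$\left\lfloor\frac d2\right\rfloor\;\leq\;\mathcal C^M_{\mathsf A_{1,d}}\;\leq\;\left\lfloor\frac d2\right\rfloor+1 .$$ -/

import Mathlib

open MeasureTheory ProbabilityTheory

noncomputable section

/-- `μ` is a representing measure of `s` with respect to the functions `a i`:
all `a i` are `μ`-integrable and `s i = ∫ a i dμ`. -/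
def IsRepresentingMeasure {X ι : Type*} [MeasurableSpace X] (a : ι → X → ℝ) (s : ι → ℝ)
    (μ : Measure X) : Prop :=
  (∀ i, Integrable (a i) μ) ∧ ∀ i, ∫ x, a i x ∂μ = s i

/-- The `k`-mixture `∑ i, c i • δ_{σ i, ξ i}` of a family of measures `δ σ ξ` on `X`, with shape
parameters `σ : S` and location parameters `ξ : Ξ`. -/
def mixture {X S Ξ : Type*} [MeasurableSpace X] (δ : S → Ξ → Measure X) {k : ℕ}
    (c : Fin k → ℝ) (σ : Fin k → S) (ξ : Fin k → Ξ) : Measure X :=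
  ∑ i, ENNReal.ofReal (c i) • δ (σ i) (ξ i)

/-- `s` has a mixture representation with `k` components (and non-negative coefficients). -/
def HasMixtureRepresentation {X S Ξ ι : Type*} [MeasurableSpace X] (a : ι → X → ℝ)
    (δ : S → Ξ → Measure X) (s : ι → ℝ) (k : ℕ) : Prop :=
  ∃ (c : Fin k → ℝ) (σ : Fin k → S) (ξ : Fin k → Ξ),
    (∀ i, 0 ≤ c i) ∧ IsRepresentingMeasure a s (mixture δ c σ ξ)

/-- The mixture cone: all sequences that have a (finite) mixture representation. -/
def mixtureCone {X S Ξ ι : Type*} [MeasurableSpace X] (a : ι → X → ℝ)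
    (δ : S → Ξ → Measure X) : Set (ι → ℝ) :=
  {s | ∃ k, HasMixtureRepresentation a δ s k}

/-- The mixture Carathéodory number of `s`: the least number of components of a mixture
representation of `s` (meaningful for `s` in the mixture cone, the only place it is used). -/
def mixtureCaratheodoryNumberOf {X S Ξ ι : Type*} [MeasurableSpace X] (a : ι → X → ℝ)
    (δ : S → Ξ → Measure X) (s : ι → ℝ) : ℕ :=
  sInf {k | HasMixtureRepresentation a δ s k}

/-- The mixture Carathéodory number: the supremum over the mixture cone, taken in `ℕ∞`
(so it is a maximum as soon as it is finite). -/
def mixtureCaratheodoryNumber {X S Ξ ι : Type*} [MeasurableSpace X] (a : ι → X → ℝ)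
    (δ : S → Ξ → Measure X) : ℕ∞ :=
  ⨆ s ∈ mixtureCone a δ, (mixtureCaratheodoryNumberOf a δ s : ℕ∞)

/-- The monomial basis `1, x, …, x ^ d` of the space `ℝ[x]_{≤ d}` of functions on `ℝ`. -/
def monomialBasis (d : ℕ) : Fin (d + 1) → ℝ → ℝ :=
  fun i x => x ^ (i : ℕ)

/-- The Gaussian measures on `ℝ` with mean `ξ` and standard deviation `σ > 0`. -/
def gaussianFamily (σ : Set.Ioi (0 : ℝ)) (ξ : ℝ) : Measure ℝ :=
  gaussianReal ξ ((σ : ℝ) ^ 2).toNNReal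

/-- The log-normal measures, as measures on `ℝ` (carried by `(0, ∞)`): the law of `exp Y` for `Y`
Gaussian with mean `log ξ` and standard deviation `σ > 0`. Here `ξ > 0` is the median, so that
these measures tend to the Dirac measure at `ξ` as `σ → 0`. -/
def logNormalFamily (σ : Set.Ioi (0 : ℝ)) (ξ : Set.Ioi (0 : ℝ)) : Measure ℝ :=
  (gaussianReal (Real.log ξ) ((σ : ℝ) ^ 2).toNNReal).map Real.exp

end

/-!
Both families are images of Gaussian measures on `ℝ` under a coordinate `φ`: `φ = id` for the
Gaussian family and `φ = exp`, with mean `log ξ`, for the log-normal one. All that matters about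
`φ` is recorded in `IsGaussianCoordinate`: it is continuous and strictly increasing, its powers are
integrable, and smoothing `φ ^ j` by a centred Gaussian gives a polynomial in `φ` of degree at most
`j`.

*Upper bound.* Choose a variance `v` strictly smaller than all variances in a given mixture. By the
semigroup property the mixture is a smoothing by `N(0, v)` of a measure with full support on the
line, and its moments up to degree `d` depend only on the moments up to degree `d` of the image
under `φ` of that measure. Gauss quadrature (`exists_gauss_quadrature`) replaces this image by
`⌊d / 2⌋ + 1` atoms in the range of `φ` without changing moments up to degree `2⌊d / 2⌋ + 1`, and
smoothing these atoms again gives a mixture with `⌊d / 2⌋ + 1` components, all of variance `v`.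
Taking `v` strictly smaller makes the functional strictly positive, so no degenerate case of the
quadrature arises.

*Lower bound.* Let `m = ⌊d / 2⌋`, and let `s` be the moment sequence of the sum of `m` very narrow
Gaussians at `0, …, m - 1`. The polynomial `p = ∏ (X - φ i) ^ 2` has degree `2m ≤ d` and tiny
`s`-integral, while the polynomials `f j = ∏_{i ≠ j} (X - φ i) ^ 2` have `s`-integrals bounded
below. Away from `j` the function `f j ∘ φ` is dominated by `p ∘ φ`, so every mixture representing
`s` has a definite amount of mass near each `j`. With fewer than `m` components, one component is
heavy near two of these points; as a Gaussian is unimodal, it is heavy on a gap between the points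
too (`exists_gap_le_of_heavy`), where `p ∘ φ` is bounded below. This contradicts the smallness of
the integral of `p`.
-/

/-! ### Gauss quadrature for positive linear functionals -/

section GaussQuadrature

open Polynomial

/-- The product of a nonzero polynomial with linear factors at some of its roots in a connected
set `I` (namely those of odd multiplicity) has constant sign on `I`. -/
theorem Polynomial.exists_finset_roots_mul_prod_sign {I : Set ℝ} (hI : IsPreconnected I)
    (P : ℝ[X]) (hP : P ≠ 0) :
    ∃ S : Finset ℝ, (∀ a ∈ S, a ∈ I) ∧ (∀ a ∈ S, P.IsRoot a) ∧
      ((∀ x ∈ I, 0 ≤ (P * ∏ a ∈ S, (X - C a)).eval x) ∨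
        (∀ x ∈ I, (P * ∏ a ∈ S, (X - C a)).eval x ≤ 0)) := by
  classical
  induction hn : P.natDegree generalizing P with
  | zero =>
    obtain ⟨c, rfl⟩ := natDegree_eq_zero.mp hn
    refine ⟨∅, by simp, by simp, ?_⟩
    rcases le_total 0 c with h | h
    · exact Or.inl fun x _ => by simpa using h
    · exact Or.inr fun x _ => by simpa using h
  | succ n ih =>
    by_cases hroot : ∃ a ∈ I, P.IsRoot a
    · obtain ⟨a, haI, ha⟩ := hroot
      obtain ⟨R, rfl⟩ := dvd_iff_isRoot.mpr ha
      have hR : R ≠ 0 := right_ne_zero_of_mul hP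
      have hdeg : R.natDegree = n := by
        rw [natDegree_mul (X_sub_C_ne_zero a) hR, natDegree_X_sub_C] at hn
        omega
      obtain ⟨S, hSI, hSR, hS⟩ := ih R hR hdeg
      by_cases haS : a ∈ S
      · refine ⟨S.erase a, fun b hb => hSI b (Finset.mem_of_mem_erase hb), fun b hb => ?_, ?_⟩
        · exact (hSR b (Finset.mem_of_mem_erase hb)).dvd (dvd_mul_left _ _)
        · have : (X - C a) * R * ∏ b ∈ S.erase a, (X - C b) = R * ∏ b ∈ S, (X - C b) := by
            rw [← Finset.mul_prod_erase S _ haS]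
            ring
          rwa [this]
      · refine ⟨insert a S, ?_, ?_, ?_⟩
        · simpa using ⟨haI, hSI⟩
        · intro b hb
          rcases Finset.mem_insert.mp hb with rfl | hb
          · exact ha
          · exact (hSR b hb).dvd (dvd_mul_left _ _)
        · have key : ∀ x, ((X - C a) * R * ∏ b ∈ insert a S, (X - C b)).eval x =
              (x - a) ^ 2 * (R * ∏ b ∈ S, (X - C b)).eval x := by
            intro x
            rw [Finset.prod_insert haS]
            simp only [eval_mul, eval_sub, eval_X, eval_C]
            ring
          simp only [key]
          rcases hS with hS | hS
          · exact Or.inl fun x hx => mul_nonneg (sq_nonneg _) (hS x hx)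
          · exact Or.inr fun x hx => mul_nonpos_of_nonneg_of_nonpos (sq_nonneg _) (hS x hx)
    · refine ⟨∅, by simp, by simp, ?_⟩
      by_contra! hcon
      obtain ⟨⟨x, hx, hx0⟩, ⟨y, hy, hy0⟩⟩ := hcon
      obtain ⟨a, haI, ha⟩ := hI.intermediate_value hx hy P.continuous.continuousOn
        (show (0 : ℝ) ∈ Set.Icc _ _ by
          simp only [Finset.prod_empty, mul_one] at hx0 hy0
          exact ⟨hx0.le, hy0.le⟩)
      exact hroot ⟨a, haI, ha⟩

/-- Existence of the monic orthogonal polynomial of degree `n`. -/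
theorem exists_monic_orthogonal (L : ℝ[X] →ₗ[ℝ] ℝ) (hL : ∀ q : ℝ[X], q ≠ 0 → 0 < L (q * q))
    (n : ℕ) : ∃ P : ℝ[X], P.Monic ∧ P.natDegree = n ∧ ∀ r : ℝ[X], r.degree < n → L (P * r) = 0 := by
  let B : degreeLT ℝ n →ₗ[ℝ] Module.Dual ℝ (degreeLT ℝ n) :=
    ((LinearMap.mul ℝ ℝ[X]).compr₂ L).compl₁₂ (degreeLT ℝ n).subtype (degreeLT ℝ n).subtype
  have hB : ∀ q r : degreeLT ℝ n, B q r = L ((q : ℝ[X]) * r) := fun q r => rfl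
  have hinj : Function.Injective B := by
    rw [injective_iff_map_eq_zero]
    intro q hq
    by_contra hne
    have h := hL q (fun h => hne (Subtype.ext h))
    rw [← hB, hq] at h
    simp at h
  have : FiniteDimensional ℝ (degreeLT ℝ n) :=
    Module.Finite.equiv (degreeLTEquiv ℝ n).symm
  have hsurj : Function.Surjective B :=
    (LinearMap.injective_iff_surjective_of_finrank_eq_finrank
      Subspace.dual_finrank_eq.symm).mp hinj
  obtain ⟨q, hq⟩ := hsurj ((L ∘ₗ LinearMap.mulLeft ℝ (X ^ n)) ∘ₗ (degreeLT ℝ n).subtype)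
  have hqd : (q : ℝ[X]).degree < n := mem_degreeLT.mp q.2
  refine ⟨X ^ n - (q : ℝ[X]), monic_X_pow_sub hqd, ?_, fun r hr => ?_⟩
  · exact natDegree_eq_of_degree_eq_some (by
      rw [degree_sub_eq_left_of_degree_lt (by rwa [degree_X_pow]), degree_X_pow])
  · have h := LinearMap.congr_fun hq ⟨r, mem_degreeLT.mpr hr⟩
    rw [hB] at h
    simp only [LinearMap.comp_apply, LinearMap.mulLeft_apply, Submodule.subtype_apply] at h
    rw [sub_mul, map_sub, h, sub_self]

/-- **Gauss quadrature**: a linear functional that is strictly positive on the nonzero polynomials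
that are nonnegative on a connected set `I` agrees, in degrees less than `2 * n`, with a
nonnegative combination of evaluations at `n` points of `I`. -/
theorem exists_gauss_quadrature {I : Set ℝ} (hI : IsPreconnected I) (L : ℝ[X] →ₗ[ℝ] ℝ)
    (hL : ∀ p : ℝ[X], p ≠ 0 → (∀ x ∈ I, 0 ≤ p.eval x) → 0 < L p) (n : ℕ) :
    ∃ (S : Finset ℝ) (w : ℝ → ℝ), S.card = n ∧ (∀ x ∈ S, x ∈ I) ∧ (∀ x ∈ S, 0 ≤ w x) ∧
      ∀ p : ℝ[X], p.natDegree < 2 * n → L p = ∑ x ∈ S, w x * p.eval x := by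
  classical
  obtain ⟨P, hPm, hPn, hPo⟩ := exists_monic_orthogonal L
    (fun q hq => hL _ (mul_ne_zero hq hq) fun x _ => by
      rw [eval_mul]; exact mul_self_nonneg _) n
  obtain ⟨S, hSI, hSP, hS⟩ := P.exists_finset_roots_mul_prod_sign hI hPm.ne_zero
  have hQm : (∏ a ∈ S, (X - C a)).Monic := monic_prod_X_sub_C _ _
  have hcard_le : S.card ≤ n := by
    rw [← hPn]
    exact (Finset.card_le_card fun a ha => by
      simpa using ⟨hPm.ne_zero, hSP a ha⟩ : S.card ≤ P.roots.toFinset.card).trans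
        ((Multiset.toFinset_card_le _).trans (card_roots' P))
  -- Otherwise `P` would be orthogonal to the product, although their product has constant sign.
  have hcard : S.card = n := by
    by_contra hne
    have hlt : S.card < n := lt_of_le_of_ne hcard_le hne
    have h0 : L (P * ∏ a ∈ S, (X - C a)) = 0 := hPo _ (by
      rw [degree_eq_natDegree hQm.ne_zero, natDegree_prod_of_monic _ _
        (fun a _ => monic_X_sub_C a)]
      simpa using hlt)
    have hne0 : P * ∏ a ∈ S, (X - C a) ≠ 0 := (hPm.mul hQm).ne_zero
    rcases hS with hS | hS
    · exact (hL _ hne0 hS).ne' h0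
    · have := hL (-(P * ∏ a ∈ S, (X - C a))) (neg_ne_zero.mpr hne0) fun x hx => by
        rw [eval_neg]; exact neg_nonneg.mpr (hS x hx)
      rw [map_neg, h0] at this
      simp at this
  let w : ℝ → ℝ := fun x => L (Lagrange.basis S id x)
  have hinj : Set.InjOn (id : ℝ → ℝ) S := Function.injective_id.injOn
  have hquad : ∀ p : ℝ[X], p.natDegree < 2 * n → L p = ∑ x ∈ S, w x * p.eval x := by
    intro p hp
    have hn : 0 < n := by omega
    have hP1 : P ≠ 1 := by
      rintro rfl
      simp at hPn
      omega
    have hr : (p %ₘ P).degree < S.card := by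
      rw [hcard, ← hPn, ← degree_eq_natDegree hPm.ne_zero]
      exact degree_modByMonic_lt p hPm
    have hq : (p /ₘ P).degree < n := by
      refine (degree_le_natDegree).trans_lt ?_
      rw [natDegree_divByMonic p hPm, hPn]
      exact_mod_cast (by omega : p.natDegree - n < n)
    have heval : ∀ x ∈ S, (p %ₘ P).eval x = p.eval x := by
      intro x hx
      conv_rhs => rw [← modByMonic_add_div p P]
      rw [eval_add, eval_mul, (hSP x hx).eq_zero, zero_mul, add_zero]
    conv_lhs => rw [← modByMonic_add_div p P]
    rw [map_add, hPo _ hq, add_zero, Lagrange.eq_interpolate hinj hr, Lagrange.interpolate_apply,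
      map_sum]
    refine Finset.sum_congr rfl fun x hx => ?_
    rw [← smul_eq_C_mul, map_smul, smul_eq_mul, mul_comm, id, heval x hx]
  refine ⟨S, w, hcard, hSI, fun x hx => ?_, hquad⟩
  -- The weight is also the value of `L` on the square of the Lagrange polynomial.
  have hn : 0 < n := hcard ▸ Finset.card_pos.mpr ⟨x, hx⟩
  have hdeg : (Lagrange.basis S id x * Lagrange.basis S id x).natDegree < 2 * n := by
    refine natDegree_mul_le.trans_lt ?_
    have := natDegree_eq_of_degree_eq_some (Lagrange.degree_basis hinj hx)
    omega
  have hsum : L (Lagrange.basis S id x * Lagrange.basis S id x) = w x := by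
    rw [hquad _ hdeg, Finset.sum_eq_single_of_mem x hx fun y hy hyx => ?_]
    · have h1 := Lagrange.eval_basis_self hinj hx
      rw [id] at h1
      rw [eval_mul, h1, mul_one, mul_one]
    · have h0 := Lagrange.eval_basis_of_ne (v := (id : ℝ → ℝ)) hyx.symm hy
      rw [id] at h0
      rw [eval_mul, h0, mul_zero, mul_zero]
  rw [← hsum]
  exact (hL _ (mul_self_ne_zero.mpr (Lagrange.basis_ne_zero hinj hx)) fun y _ => by
    rw [eval_mul]; exact mul_self_nonneg _).le

end GaussQuadrature

/-! ### Coordinates in which Gaussian measures have polynomial moments -/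

open scoped NNReal in
/-- A strictly increasing continuous coordinate `φ` on `ℝ` all of whose powers are integrable for
every Gaussian measure, and such that smoothing `φ ^ j` by a centred Gaussian gives a polynomial in
`φ` of degree at most `j`. The two instances of interest are `φ = id` and `φ = exp`. -/
structure IsGaussianCoordinate (φ : ℝ → ℝ) : Prop where
  continuous : Continuous φ
  strictMono : StrictMono φ
  integrable_pow : ∀ (y : ℝ) (v : ℝ≥0) (j : ℕ), Integrable (fun x => φ x ^ j) (gaussianReal y v)
  exists_polynomial : ∀ (v : ℝ≥0) (j : ℕ), ∃ q : Polynomial ℝ, q.natDegree ≤ j ∧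
    ∀ y, ∫ z, φ (y + z) ^ j ∂gaussianReal 0 v = q.eval (φ y)

/-- The laws of `φ Y` for `Y` Gaussian with mean `y` and standard deviation `σ > 0`. -/
noncomputable def gaussianImageFamily (φ : ℝ → ℝ) (σ : Set.Ioi (0 : ℝ)) (y : ℝ) : Measure ℝ :=
  (gaussianReal y ((σ : ℝ) ^ 2).toNNReal).map φ

namespace IsGaussianCoordinate

open Polynomial
open scoped NNReal

theorem id : IsGaussianCoordinate (fun x => x) where
  continuous := continuous_id
  strictMono := strictMono_id
  integrable_pow y v j := by
    have h := (memLp_id_gaussianReal (μ := y) (v := v) j).integrable_norm_pow'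
    refine h.mono' (by fun_prop) (Filter.Eventually.of_forall fun x => ?_)
    simp
  exists_polynomial v j := by
    have hint : ∀ n : ℕ, Integrable (fun z : ℝ => z ^ n) (gaussianReal 0 v) := fun n => by
      have h := (memLp_id_gaussianReal (μ := 0) (v := v) n).integrable_norm_pow'
      refine h.mono' (by fun_prop) (Filter.Eventually.of_forall fun x => ?_)
      simp
    refine ⟨∑ m ∈ Finset.range (j + 1),
      C ((∫ z, z ^ (j - m) ∂gaussianReal 0 v) * (j.choose m : ℝ)) * X ^ m, ?_, fun y => ?_⟩
    · refine natDegree_sum_le_of_forall_le _ _ fun m hm => ?_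
      exact (natDegree_C_mul_X_pow_le _ _).trans (Nat.lt_succ_iff.mp (Finset.mem_range.mp hm))
    · simp_rw [add_pow]
      rw [integral_finsetSum _ fun m _ => ((hint (j - m)).const_mul _).mul_const _,
        eval_finsetSum]
      refine Finset.sum_congr rfl fun m _ => ?_
      rw [integral_mul_const, integral_const_mul]
      simp only [eval_mul, eval_C, eval_pow, eval_X]
      ring

theorem exp : IsGaussianCoordinate Real.exp where
  continuous := Real.continuous_exp
  strictMono := Real.exp_strictMono
  integrable_pow y v j := by
    simp_rw [← Real.exp_nat_mul]
    exact integrable_exp_mul_gaussianReal _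
  exists_polynomial v j := by
    refine ⟨C (∫ z, Real.exp z ^ j ∂gaussianReal 0 v) * X ^ j, natDegree_C_mul_X_pow_le _ _,
      fun y => ?_⟩
    simp_rw [Real.exp_add, mul_pow]
    rw [integral_const_mul]
    simp only [eval_mul, eval_C, eval_pow, eval_X]
    ring

variable {φ : ℝ → ℝ}

theorem integrable_eval (h : IsGaussianCoordinate φ) (y : ℝ) (v : ℝ≥0) (P : ℝ[X]) :
    Integrable (fun x => P.eval (φ x)) (gaussianReal y v) := by
  simp_rw [eval_eq_sum_range]
  exact integrable_finsetSum _ fun j _ => (h.integrable_pow y v j).const_mul _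

/-- The functional `P ↦ 𝔼[P (φ Y)]` for `Y` Gaussian with mean `y` and variance `v`. -/
noncomputable def expectation (h : IsGaussianCoordinate φ) (y : ℝ) (v : ℝ≥0) : ℝ[X] →ₗ[ℝ] ℝ where
  toFun P := ∫ x, P.eval (φ x) ∂gaussianReal y v
  map_add' P Q := by
    simp_rw [eval_add]
    exact integral_add (h.integrable_eval y v P) (h.integrable_eval y v Q)
  map_smul' r P := by
    simp_rw [eval_smul, smul_eq_mul]
    exact integral_const_mul _ _

theorem expectation_apply (h : IsGaussianCoordinate φ) (y : ℝ) (v : ℝ≥0) (P : ℝ[X]) :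
    h.expectation y v P = ∫ x, P.eval (φ x) ∂gaussianReal y v := rfl

theorem expectation_pos (h : IsGaussianCoordinate φ) (y : ℝ) {v : ℝ≥0} (hv : v ≠ 0) {P : ℝ[X]}
    (hP : P ≠ 0) (hpos : ∀ x ∈ Set.range φ, 0 ≤ P.eval x) : 0 < h.expectation y v P := by
  have : (gaussianReal y v).IsOpenPosMeasure :=
    (gaussianReal_absolutelyContinuous' y hv).isOpenPosMeasure
  have hne : ∃ x, P.eval (φ x) ≠ 0 := by
    by_contra! hzero
    exact hP (eq_zero_of_infinite_isRoot P
      ((Set.infinite_range_of_injective h.strictMono.injective).mono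
        (by rintro _ ⟨x, rfl⟩; exact hzero x)))
  obtain ⟨x, hx⟩ := hne
  exact integral_pos_of_integrable_nonneg_nonzero (P.continuous.comp h.continuous)
    (h.integrable_eval y v P) (fun x => hpos _ ⟨x, rfl⟩) hx

/-- The semigroup property: a Gaussian of variance `w + v` is one of variance `w` smoothed by a
centred Gaussian of variance `v`. -/
theorem integral_pow_gaussianReal_add (h : IsGaussianCoordinate φ) (y : ℝ) (w v : ℝ≥0) (j : ℕ) :
    ∫ x, φ x ^ j ∂gaussianReal y (w + v) =
      ∫ x, ∫ z, φ (x + z) ^ j ∂gaussianReal 0 v ∂gaussianReal y w := by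
  have hconv : gaussianReal y (w + v) =
      ((gaussianReal y w).prod (gaussianReal 0 v)).map (fun p : ℝ × ℝ => p.1 + p.2) := by
    have := gaussianReal_conv_gaussianReal (m₁ := y) (m₂ := 0) (v₁ := w) (v₂ := v)
    rw [add_zero] at this
    exact this.symm
  have hm : AEStronglyMeasurable (fun x => φ x ^ j)
      (((gaussianReal y w).prod (gaussianReal 0 v)).map (fun p : ℝ × ℝ => p.1 + p.2)) :=
    (h.continuous.pow j).aestronglyMeasurable
  have hint := h.integrable_pow y (w + v) j
  rw [hconv] at hint ⊢
  rw [integral_map (by fun_prop) hm]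
  exact integral_prod _ ((integrable_map_measure hm (by fun_prop)).mp hint)

theorem integral_pow_gaussianReal_eq (h : IsGaussianCoordinate φ) (y : ℝ) (v : ℝ≥0) (j : ℕ) :
    ∫ x, φ x ^ j ∂gaussianReal y v = ∫ z, φ (y + z) ^ j ∂gaussianReal 0 v := by
  have := h.integral_pow_gaussianReal_add y 0 v j
  rwa [zero_add, gaussianReal_zero_var, integral_dirac] at this

/-- Mixture representations of moment sequences, written with integrals on the `Y`-line. -/
theorem hasMixtureRepresentation_iff (h : IsGaussianCoordinate φ) {d k : ℕ}
    {s : Fin (d + 1) → ℝ} :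
    HasMixtureRepresentation (monomialBasis d) (gaussianImageFamily φ) s k ↔
      ∃ (c : Fin k → ℝ) (σ : Fin k → Set.Ioi (0 : ℝ)) (y : Fin k → ℝ), (∀ i, 0 ≤ c i) ∧
        ∀ j : Fin (d + 1),
          ∑ i, c i * ∫ x, φ x ^ (j : ℕ) ∂gaussianReal (y i) ((σ i : ℝ) ^ 2).toNNReal = s j := by
  have hmeas : ∀ (y : ℝ) (v : ℝ≥0), AEMeasurable φ (gaussianReal y v) :=
    fun y v => h.continuous.measurable.aemeasurable
  have hint : ∀ (σ : Set.Ioi (0 : ℝ)) (y : ℝ) (j : Fin (d + 1)),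
      Integrable (monomialBasis d j) (gaussianImageFamily φ σ y) := fun σ y j =>
    (integrable_map_measure (continuous_pow (j : ℕ)).aestronglyMeasurable (hmeas _ _)).mpr
      (h.integrable_pow y _ j)
  unfold HasMixtureRepresentation
  refine exists_congr fun c => exists_congr fun σ => exists_congr fun y =>
    and_congr_right fun hc => ?_
  have hint' : ∀ (j : Fin (d + 1)) (i : Fin k), Integrable (monomialBasis d j)
      (ENNReal.ofReal (c i) • gaussianImageFamily φ (σ i) (y i)) := fun j i =>
    (hint _ _ j).smul_measure ENNReal.ofReal_ne_top
  have key : ∀ j : Fin (d + 1),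
      ∫ x, monomialBasis d j x ∂mixture (gaussianImageFamily φ) c σ y =
      ∑ i, c i * ∫ x, φ x ^ (j : ℕ) ∂gaussianReal (y i) ((σ i : ℝ) ^ 2).toNNReal := by
    intro j
    rw [mixture, integral_finsetSum_measure fun i _ => hint' j i]
    refine Finset.sum_congr rfl fun i _ => ?_
    rw [integral_smul_measure, ENNReal.toReal_ofReal (hc i), smul_eq_mul, gaussianImageFamily,
      integral_map (hmeas _ _) (show AEStronglyMeasurable (monomialBasis d j) _ from
        (continuous_pow (j : ℕ)).aestronglyMeasurable)]
    rfl
  refine ⟨fun hr j => (key j).symm.trans (hr.2 j), fun hr =>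
    ⟨fun j => ?_, fun j => (key j).trans (hr j)⟩⟩
  exact integrable_finsetSum_measure.mpr fun i _ => hint' j i

/-! ### The upper bound -/

/-- Every moment sequence in the mixture cone has a representation with `n` components of equal
variance as soon as Gauss quadrature with `n` nodes is exact in degree `d`. -/
theorem exists_hasMixtureRepresentation_le (h : IsGaussianCoordinate φ) {d n : ℕ}
    (hn : d < 2 * n) {s : Fin (d + 1) → ℝ}
    (hs : s ∈ mixtureCone (monomialBasis d) (gaussianImageFamily φ)) :
    ∃ k ≤ n, HasMixtureRepresentation (monomialBasis d) (gaussianImageFamily φ) s k := by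
  obtain ⟨k, hk⟩ := hs
  obtain ⟨c, σ, y, hc, hmom⟩ := h.hasMixtureRepresentation_iff.mp hk
  by_cases hc0 : ∃ i, 0 < c i
  swap
  · refine ⟨0, Nat.zero_le _, h.hasMixtureRepresentation_iff.mpr
      ⟨Fin.elim0, Fin.elim0, Fin.elim0, fun i => i.elim0, fun j => ?_⟩⟩
    push Not at hc0
    rw [← hmom j]
    simp [fun i => le_antisymm (hc0 i) (hc i)]
  obtain ⟨i₀, hi₀⟩ := hc0
  -- A common standard deviation, strictly smaller than all the given ones, is split off.
  obtain ⟨τ, hτ, hτσ⟩ : ∃ τ : ℝ, 0 < τ ∧ ∀ i, τ < σ i := by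
    have hev : ∀ᶠ τ in nhdsWithin (0 : ℝ) (Set.Ioi 0), 0 < τ ∧ ∀ i, τ < (σ i : ℝ) :=
      eventually_mem_nhdsWithin.and (Filter.eventually_all.mpr fun i =>
        Filter.Eventually.filter_mono nhdsWithin_le_nhds (eventually_lt_nhds (σ i).2))
    exact hev.exists
  set v : ℝ≥0 := (τ ^ 2).toNNReal with hv
  have hlt : ∀ i, v < ((σ i : ℝ) ^ 2).toNNReal := fun i =>
    (Real.toNNReal_lt_toNNReal_iff (pow_pos (σ i).2 2)).mpr
      (pow_lt_pow_left₀ (hτσ i) hτ.le two_ne_zero)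
  let L : ℝ[X] →ₗ[ℝ] ℝ := ∑ i, c i • h.expectation (y i) (((σ i : ℝ) ^ 2).toNNReal - v)
  have hLapply : ∀ P, L P = ∑ i, c i * h.expectation (y i) (((σ i : ℝ) ^ 2).toNNReal - v) P :=
    fun P => by simp [L, LinearMap.sum_apply]
  have hLpos : ∀ P : ℝ[X], P ≠ 0 → (∀ x ∈ Set.range φ, 0 ≤ P.eval x) → 0 < L P := by
    intro P hP hpos
    have hE : ∀ i, 0 < h.expectation (y i) (((σ i : ℝ) ^ 2).toNNReal - v) P := fun i =>
      h.expectation_pos _ (tsub_pos_of_lt (hlt i)).ne' hP hpos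
    rw [hLapply]
    exact Finset.sum_pos' (fun i _ => mul_nonneg (hc i) (hE i).le)
      ⟨i₀, Finset.mem_univ _, mul_pos hi₀ (hE i₀)⟩
  obtain ⟨S, w, hcard, hSφ, hw, hquad⟩ :=
    exists_gauss_quadrature (isPreconnected_range h.continuous) L hLpos n
  have e : Fin n ≃ S := (S.equivFinOfCardEq hcard).symm
  choose! u hu using hSφ
  refine ⟨n, le_rfl, h.hasMixtureRepresentation_iff.mpr
    ⟨fun i => w (e i), fun _ => ⟨τ, hτ⟩, fun i => u (e i), fun i => hw _ (e i).2, fun j => ?_⟩⟩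
  obtain ⟨q, hqdeg, hq⟩ := h.exists_polynomial v j
  have hqd : q.natDegree < 2 * n := by have := j.2; omega
  calc ∑ i, w (e i) * ∫ x, φ x ^ (j : ℕ) ∂gaussianReal (u (e i)) v
      = ∑ i, w (e i) * q.eval (e i : ℝ) := by
        refine Finset.sum_congr rfl fun i _ => ?_
        rw [h.integral_pow_gaussianReal_eq, hq, hu _ (e i).2]
    _ = ∑ x ∈ S, w x * q.eval x := by
        rw [e.sum_comp (fun x : S => w x * q.eval (x : ℝ)),
          Finset.sum_coe_sort S (fun x => w x * q.eval x)]
    _ = L q := (hquad q hqd).symm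
    _ = s j := by
        rw [hLapply, ← hmom j]
        refine Finset.sum_congr rfl fun i _ => ?_
        rw [expectation_apply]
        simp_rw [← hq]
        rw [← h.integral_pow_gaussianReal_add, tsub_add_cancel_of_le (hlt i).le]

end IsGaussianCoordinate

/-! ### Unimodality of Gaussian measures -/

open scoped NNReal in
/-- If the points of `S` are at least as close to the mean `y` as to `y + t`, then `S` has at least
the Gaussian mass of its translate by `-t`. -/
theorem gaussianReal_preimage_add_le {y t : ℝ} {v : ℝ≥0} (hv : v ≠ 0) {S : Set ℝ}
    (hS : MeasurableSet S) (h : ∀ x ∈ S, |x - y| ≤ |x - (y + t)|) :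
    gaussianReal y v ((· + t) ⁻¹' S) ≤ gaussianReal y v S := by
  rw [← Measure.map_apply (measurable_add_const t) hS, gaussianReal_map_add_const,
    gaussianReal_apply _ hv, gaussianReal_apply _ hv]
  refine setLIntegral_mono (measurable_gaussianPDF _ _) fun x hx => ENNReal.ofReal_le_ofReal ?_
  have := sq_le_sq.mpr (h x hx)
  rw [gaussianPDFReal, gaussianPDFReal]
  gcongr

open scoped NNReal in
/-- A Gaussian measure gives the gap between two separated intervals of the same length at least
the mass of one of them: move the interval on the far side of the mean towards the mean. -/
theorem gaussianReal_min_le_gap (y : ℝ) {v : ℝ≥0} (hv : v ≠ 0) {a b : ℝ} (hab : a + 1 ≤ b) :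
    min ((gaussianReal y v).real (Set.Icc (a - 1 / 4) (a + 1 / 4)))
      ((gaussianReal y v).real (Set.Icc (b - 1 / 4) (b + 1 / 4))) ≤
      (gaussianReal y v).real (Set.Icc (a + 1 / 4) (a + 3 / 4)) := by
  rcases le_total (a + 1 / 2) y with hy | hy
  · refine (min_le_left _ _).trans (ENNReal.toReal_mono (measure_ne_top _ _) ?_)
    convert gaussianReal_preimage_add_le (t := 1 / 2) hv
      (measurableSet_Icc (a := a + 1 / 4) (b := a + 3 / 4)) fun x hx => ?_ using 2
    · rw [Set.preimage_add_const_Icc]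
      congr 1 <;> ring
    · obtain ⟨h1, h2⟩ := hx
      rw [abs_sub_comm x (y + 1 / 2), abs_of_nonneg (by linarith : 0 ≤ y + 1 / 2 - x), abs_le]
      constructor <;> linarith
  · refine (min_le_right _ _).trans (ENNReal.toReal_mono (measure_ne_top _ _) ?_)
    convert gaussianReal_preimage_add_le (t := a + 1 / 2 - b) hv
      (measurableSet_Icc (a := a + 1 / 4) (b := a + 3 / 4)) fun x hx => ?_ using 2
    · rw [Set.preimage_add_const_Icc]
      congr 1 <;> ring
    · obtain ⟨h1, h2⟩ := hx
      rw [abs_of_nonneg (by linarith : 0 ≤ x - (y + (a + 1 / 2 - b))), abs_le]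
      constructor <;> linarith

open scoped NNReal in
/-- A mixture of fewer than `m` Gaussians cannot put mass at least `m * δ` near each of the points
`0, …, m - 1` and mass less than `δ` on each of the gaps between them: one component is heavy near
two of the points, hence on a gap. -/
theorem exists_gap_le_of_heavy {m k : ℕ} (hkm : k < m) {c : Fin k → ℝ} (hc : ∀ i, 0 ≤ c i)
    (y : Fin k → ℝ) {v : Fin k → ℝ≥0} (hv : ∀ i, v i ≠ 0) {δ : ℝ} (hδ : 0 < δ)
    (hheavy : ∀ j : Fin m, m * δ ≤
      ∑ i, c i * (gaussianReal (y i) (v i)).real (Set.Icc ((j : ℝ) - 1 / 4) ((j : ℝ) + 1 / 4))) :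
    ∃ (j : Fin m) (i : Fin k), δ ≤
      c i * (gaussianReal (y i) (v i)).real (Set.Icc ((j : ℝ) + 1 / 4) ((j : ℝ) + 3 / 4)) := by
  have hcomp : ∀ j : Fin m, ∃ i, δ ≤
      c i * (gaussianReal (y i) (v i)).real (Set.Icc ((j : ℝ) - 1 / 4) ((j : ℝ) + 1 / 4)) := by
    intro j
    by_contra! hlt
    have h1 := Finset.sum_le_sum fun (i : Fin k) (_ : i ∈ Finset.univ) => (hlt i).le
    rw [Finset.sum_const, Finset.card_univ, Fintype.card_fin, nsmul_eq_mul] at h1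
    have h2 : (k : ℝ) < m := by exact_mod_cast hkm
    nlinarith [hheavy j]
  choose g hg using hcomp
  obtain ⟨j, j', hne, hjj⟩ := Fintype.exists_ne_map_eq_of_card_lt g (by simpa using hkm)
  wlog hlt : j < j' generalizing j j'
  · exact this j' j hne.symm hjj.symm (lt_of_le_of_ne (not_lt.mp hlt) hne.symm)
  refine ⟨j, g j, ?_⟩
  have hsep : (j : ℝ) + 1 ≤ (j' : ℝ) := by exact_mod_cast hlt
  have h1 := hg j
  have h2 := hg j'
  rw [← hjj] at h2
  rcases min_le_iff.mp (gaussianReal_min_le_gap (y (g j)) (hv (g j)) hsep) with h3 | h3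
  · exact h1.trans (mul_le_mul_of_nonneg_left h3 (hc _))
  · exact h2.trans (mul_le_mul_of_nonneg_left h3 (hc _))

/-! ### The lower bound -/

namespace IsGaussianCoordinate

open Polynomial Filter Topology
open scoped NNReal

variable {φ : ℝ → ℝ}

theorem expectation_eq_sum (h : IsGaussianCoordinate φ) (y : ℝ) (v : ℝ≥0) {P : ℝ[X]} {d : ℕ}
    (hP : P.natDegree ≤ d) : h.expectation y v P =
      ∑ j ∈ Finset.range (d + 1), P.coeff j * ∫ x, φ x ^ j ∂gaussianReal y v := by
  rw [expectation_apply]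
  simp_rw [eval_eq_sum_range' (Nat.lt_succ_of_le hP)]
  rw [integral_finsetSum _ fun j _ => (h.integrable_pow y v j).const_mul _]
  simp_rw [integral_const_mul]

theorem integral_pow_gaussianReal_scale (h : IsGaussianCoordinate φ) (y σ : ℝ) (j : ℕ) :
    Integrable (fun z => φ (y + σ * z) ^ j) (gaussianReal 0 1) ∧
      ∫ x, φ x ^ j ∂gaussianReal y (σ ^ 2).toNNReal =
        ∫ z, φ (y + σ * z) ^ j ∂gaussianReal 0 1 := by
  have hmap : gaussianReal y (σ ^ 2).toNNReal =
      (gaussianReal 0 1).map (fun z => y + σ * z) := by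
    have h1 := gaussianReal_map_const_mul (μ := 0) (v := 1) σ
    have h2 := gaussianReal_map_const_add (μ := 0) (v := (σ ^ 2).toNNReal) y
    rw [mul_zero, mul_one, ← Real.toNNReal_of_nonneg] at h1
    rw [zero_add] at h2
    rw [← h2, ← h1, Measure.map_map (by fun_prop) (by fun_prop)]
    rfl
  have hm : AEStronglyMeasurable (fun x => φ x ^ j)
      ((gaussianReal 0 1).map (fun z => y + σ * z)) :=
    (h.continuous.pow j).aestronglyMeasurable
  have hint := h.integrable_pow y (σ ^ 2).toNNReal j
  rw [hmap] at hint ⊢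
  exact ⟨(integrable_map_measure hm (by fun_prop)).mp hint, integral_map (by fun_prop) hm⟩

/-- As the variance tends to `0`, the Gaussian expectation tends to the evaluation at the mean. -/
theorem tendsto_expectation (h : IsGaussianCoordinate φ) (y : ℝ) (P : ℝ[X]) :
    Tendsto (fun σ : ℝ => h.expectation y (σ ^ 2).toNNReal P) (𝓝[>] 0) (𝓝 (P.eval (φ y))) := by
  have hpow : ∀ j : ℕ, Tendsto (fun σ : ℝ => ∫ x, φ x ^ j ∂gaussianReal y (σ ^ 2).toNNReal)
      (𝓝[>] 0) (𝓝 (φ y ^ j)) := by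
    intro j
    have hlim : φ y ^ j = ∫ _z, φ y ^ j ∂gaussianReal 0 1 := by simp
    simp_rw [fun σ => (h.integral_pow_gaussianReal_scale y σ j).2]
    rw [hlim]
    refine tendsto_integral_filter_of_dominated_convergence
      (fun z => ‖φ (y + (-1) * z) ^ j‖ + ‖φ (y + 1 * z) ^ j‖) ?_ ?_
      ((h.integral_pow_gaussianReal_scale y (-1) j).1.norm.add
        (h.integral_pow_gaussianReal_scale y 1 j).1.norm) ?_
    · exact Eventually.of_forall fun σ =>
        (h.integral_pow_gaussianReal_scale y σ j).1.aestronglyMeasurable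
    -- Monotonicity of `φ` bounds `φ` by its values at the ends of an interval.
    · filter_upwards [Ioo_mem_nhdsGT (zero_lt_one' ℝ)] with σ hσ
      refine Eventually.of_forall fun z => ?_
      have hz : ∀ u w t : ℝ, u ≤ t → t ≤ w → ‖φ t ^ j‖ ≤ ‖φ u ^ j‖ + ‖φ w ^ j‖ := by
        intro u w t hut htw
        simp only [norm_pow, Real.norm_eq_abs]
        have hle := abs_le_max_abs_abs (h.strictMono.monotone hut) (h.strictMono.monotone htw)
        rcases le_total |φ u| |φ w| with h' | h'
        · rw [max_eq_right h'] at hle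
          linarith [pow_le_pow_left₀ (abs_nonneg _) hle j, pow_nonneg (abs_nonneg (φ u)) j]
        · rw [max_eq_left h'] at hle
          linarith [pow_le_pow_left₀ (abs_nonneg _) hle j, pow_nonneg (abs_nonneg (φ w)) j]
      rcases le_total 0 z with h0 | h0
      · exact hz _ _ _ (by nlinarith [hσ.1, hσ.2]) (by nlinarith [hσ.1, hσ.2])
      · rw [add_comm ‖φ (y + -1 * z) ^ j‖]
        exact hz _ _ _ (by nlinarith [hσ.1, hσ.2]) (by nlinarith [hσ.1, hσ.2])
    · refine Eventually.of_forall fun z => ?_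
      have hc : Continuous fun σ : ℝ => φ (y + σ * z) ^ j :=
        (h.continuous.comp (by fun_prop)).pow j
      have := hc.tendsto 0
      simp only [zero_mul, add_zero] at this
      exact this.mono_left nhdsWithin_le_nhds
  simp_rw [h.expectation_eq_sum y _ le_rfl]
  rw [eval_eq_sum_range]
  exact tendsto_finsetSum _ fun j _ => (hpow j).const_mul _

theorem expectation_nonneg (h : IsGaussianCoordinate φ) (y : ℝ) (v : ℝ≥0) {P : ℝ[X]}
    (hP : ∀ x, 0 ≤ P.eval x) : 0 ≤ h.expectation y v P :=
  integral_nonneg fun x => hP (φ x)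

/-- Moment sequences determine the integrals of polynomials of degree at most `d`. -/
theorem sum_expectation_eq (h : IsGaussianCoordinate φ) {d k l : ℕ}
    {c : Fin k → ℝ} {y : Fin k → ℝ} {v : Fin k → ℝ≥0}
    {c' : Fin l → ℝ} {y' : Fin l → ℝ} {v' : Fin l → ℝ≥0}
    (hmom : ∀ j : Fin (d + 1), ∑ i, c i * ∫ x, φ x ^ (j : ℕ) ∂gaussianReal (y i) (v i) =
      ∑ i, c' i * ∫ x, φ x ^ (j : ℕ) ∂gaussianReal (y' i) (v' i))
    {P : ℝ[X]} (hP : P.natDegree ≤ d) :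
    ∑ i, c i * h.expectation (y i) (v i) P = ∑ i, c' i * h.expectation (y' i) (v' i) P := by
  simp_rw [h.expectation_eq_sum _ _ hP, Finset.sum_range, Finset.mul_sum]
  rw [Finset.sum_comm, Finset.sum_comm (s := Finset.univ (α := Fin l))]
  refine Finset.sum_congr rfl fun j _ => ?_
  simp_rw [mul_left_comm _ (P.coeff j), ← Finset.mul_sum, hmom j]

/-- A mixture of `m` sufficiently narrow Gaussians centred at `0, …, m - 1` has a moment sequence
of degree `d ≥ 2 * m` that is not represented by fewer than `m` components. -/
theorem exists_not_hasMixtureRepresentation (h : IsGaussianCoordinate φ) {d m : ℕ}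
    (hmd : 2 * m ≤ d) :
    ∃ s ∈ mixtureCone (monomialBasis d) (gaussianImageFamily φ),
      ∀ k < m, ¬ HasMixtureRepresentation (monomialBasis d) (gaussianImageFamily φ) s k := by
  rcases Nat.eq_zero_or_pos m with rfl | hm
  · exact ⟨0, ⟨0, h.hasMixtureRepresentation_iff.mpr ⟨Fin.elim0, Fin.elim0, Fin.elim0,
      fun i => i.elim0, fun j => by simp⟩⟩, fun k hk => absurd hk (Nat.not_lt_zero k)⟩
  have hm0 : (0 : ℝ) < m := by exact_mod_cast hm
  let p : ℝ[X] := ∏ i : Fin m, (X - C (φ i)) ^ 2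
  let f : Fin m → ℝ[X] := fun j => ∏ i ∈ Finset.univ.erase j, (X - C (φ i)) ^ 2
  have hpf : ∀ (j : Fin m) x, p.eval x = (x - φ j) ^ 2 * (f j).eval x := by
    intro j x
    have : p = (X - C (φ j)) ^ 2 * f j :=
      (Finset.mul_prod_erase Finset.univ (fun i : Fin m => (X - C (φ i)) ^ 2)
        (Finset.mem_univ j)).symm
    simp [this]
  have hpeval : ∀ x, p.eval x = ∏ i : Fin m, (x - φ i) ^ 2 := fun x => by simp [p, eval_prod]
  have hfeval : ∀ (j : Fin m) x, (f j).eval x = ∏ i ∈ Finset.univ.erase j, (x - φ i) ^ 2 :=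
    fun j x => by simp [f, eval_prod]
  have hp0 : ∀ x, 0 ≤ p.eval x := fun x => by
    rw [hpeval]; exact Finset.prod_nonneg fun i _ => sq_nonneg _
  have hf0 : ∀ (j : Fin m) x, 0 ≤ (f j).eval x := fun j x => by
    rw [hfeval]; exact Finset.prod_nonneg fun i _ => sq_nonneg _
  have hpdeg : p.natDegree ≤ d := by
    refine (natDegree_prod_le _ _).trans (le_trans (le_of_eq ?_) hmd)
    simp [natDegree_pow, mul_comm]
  have hfdeg : ∀ j : Fin m, (f j).natDegree ≤ d := by
    intro j
    refine (natDegree_prod_le _ _).trans (le_trans ?_ hmd)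
    simp only [natDegree_pow, natDegree_X_sub_C, mul_one, Finset.sum_const, smul_eq_mul,
      Finset.card_erase_of_mem (Finset.mem_univ j), Finset.card_univ, Fintype.card_fin]
    omega
  have : Nonempty (Fin m) := ⟨⟨0, hm⟩⟩
  -- `ρ` bounds the distance of `φ y` to `φ j` from below for `y` outside the ball around `j`.
  obtain ⟨ρ, hρ, hρφ⟩ : ∃ ρ > 0, ∀ (j : Fin m) (y : ℝ),
      y ≤ j - 1 / 4 ∨ (j : ℝ) + 1 / 4 ≤ y → ρ ^ 2 ≤ (φ y - φ j) ^ 2 := by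
    obtain ⟨j₀, hj₀⟩ := Finite.exists_min
      fun j : Fin m => min (φ j - φ ((j : ℝ) - 1 / 4)) (φ ((j : ℝ) + 1 / 4) - φ j)
    refine ⟨_, lt_min (sub_pos.mpr (h.strictMono (by linarith : (j₀ : ℝ) - 1 / 4 < j₀)))
      (sub_pos.mpr (h.strictMono (by linarith : (j₀ : ℝ) < j₀ + 1 / 4))), fun j y hy => ?_⟩
    have hpos : 0 ≤ min (φ j₀ - φ ((j₀ : ℝ) - 1 / 4)) (φ ((j₀ : ℝ) + 1 / 4) - φ j₀) :=
      (lt_min (sub_pos.mpr (h.strictMono (by linarith : (j₀ : ℝ) - 1 / 4 < j₀)))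
        (sub_pos.mpr (h.strictMono (by linarith : (j₀ : ℝ) < j₀ + 1 / 4)))).le
    have hmin := hj₀ j
    rcases hy with hy | hy
    · have h1 := h.strictMono.monotone hy
      have h2 := hmin.trans (min_le_left _ _)
      rw [← neg_sub (φ j) (φ y), neg_sq]
      exact pow_le_pow_left₀ hpos (by linarith) 2
    · have h1 := h.strictMono.monotone hy
      have h2 := hmin.trans (min_le_right _ _)
      exact pow_le_pow_left₀ hpos (by linarith) 2
  obtain ⟨B, hB, hfB⟩ : ∃ B > 0, ∀ (j : Fin m),
      ∀ y ∈ Set.Icc ((j : ℝ) - 1 / 4) ((j : ℝ) + 1 / 4), (f j).eval (φ y) ≤ B := by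
    have hbd : ∀ j : Fin m, ∃ M, ∀ y ∈ Set.Icc ((j : ℝ) - 1 / 4) ((j : ℝ) + 1 / 4),
        (f j).eval (φ y) ≤ M := fun j => by
      obtain ⟨M, hM⟩ := isCompact_Icc.bddAbove_image
        (((f j).continuous.comp h.continuous).continuousOn
          (s := Set.Icc ((j : ℝ) - 1 / 4) ((j : ℝ) + 1 / 4)))
      exact ⟨M, fun y hy => hM ⟨y, hy, rfl⟩⟩
    choose M hM using hbd
    obtain ⟨j₀, hj₀⟩ := Finite.exists_max M
    exact ⟨max 1 (M j₀), lt_max_of_lt_left one_pos, fun j y hy =>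
      (hM j y hy).trans ((hj₀ j).trans (le_max_right _ _))⟩
  obtain ⟨a, ha, hfa⟩ : ∃ a > 0, ∀ j : Fin m, a ≤ (f j).eval (φ j) := by
    obtain ⟨j₀, hj₀⟩ := Finite.exists_min fun j : Fin m => (f j).eval (φ j)
    refine ⟨_, ?_, hj₀⟩
    rw [hfeval]
    refine Finset.prod_pos fun i hi => sq_pos_iff.mpr (sub_ne_zero.mpr fun heq => ?_)
    exact Finset.ne_of_mem_erase hi (Fin.ext (by exact_mod_cast (h.strictMono.injective heq).symm))
  -- The mass of one component near a point that the test functions `f j` force.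
  set δ : ℝ := a / (4 * B * m) with hδdef
  have hδ : 0 < δ := by positivity
  set ε : ℝ := min (a * ρ ^ 2 / 4) ((ρ ^ 2) ^ m * δ) with hεdef
  have hε : 0 < ε := lt_min (by positivity) (by positivity)
  obtain ⟨σ, hσ, hσp, hσf⟩ : ∃ σ : ℝ, 0 < σ ∧
      ∑ i : Fin m, 1 * h.expectation i (σ ^ 2).toNNReal p < ε ∧
      ∀ j : Fin m, a / 2 < h.expectation j (σ ^ 2).toNNReal (f j) := by
    have hlim : Tendsto (fun σ : ℝ => ∑ i : Fin m, 1 * h.expectation i (σ ^ 2).toNNReal p)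
        (𝓝[>] 0) (𝓝 (∑ i : Fin m, 1 * p.eval (φ i))) :=
      tendsto_finsetSum _ fun i _ => (h.tendsto_expectation i p).const_mul 1
    have hzero : ∑ i : Fin m, 1 * p.eval (φ i) = 0 :=
      Finset.sum_eq_zero fun i _ => by rw [hpf i]; ring
    rw [hzero] at hlim
    have hev : ∀ᶠ σ : ℝ in 𝓝[>] 0, 0 < σ ∧
        ∑ i : Fin m, 1 * h.expectation i (σ ^ 2).toNNReal p < ε ∧
        ∀ j : Fin m, a / 2 < h.expectation j (σ ^ 2).toNNReal (f j) :=
      eventually_mem_nhdsWithin.and ((hlim.eventually_lt_const hε).and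
        (eventually_all.mpr fun j => (h.tendsto_expectation j (f j)).eventually_const_lt
          (by linarith [hfa j])))
    exact hev.exists
  refine ⟨fun j => ∑ i : Fin m, 1 * ∫ x, φ x ^ (j : ℕ) ∂gaussianReal i (σ ^ 2).toNNReal,
    ⟨m, h.hasMixtureRepresentation_iff.mpr ⟨fun _ => 1, fun _ => ⟨σ, hσ⟩, fun i => i,
      fun _ => zero_le_one, fun j => rfl⟩⟩, fun k hk hrep => ?_⟩
  obtain ⟨c, τ, y, hc, hmom⟩ := h.hasMixtureRepresentation_iff.mp hrep
  set v : Fin k → ℝ≥0 := fun i => ((τ i : ℝ) ^ 2).toNNReal with hvdef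
  have hv : ∀ i, v i ≠ 0 := fun i => (Real.toNNReal_pos.mpr (pow_pos (τ i).2 2)).ne'
  have hexp : ∀ P : ℝ[X], P.natDegree ≤ d → ∑ i, c i * h.expectation (y i) (v i) P =
      ∑ i : Fin m, 1 * h.expectation i (σ ^ 2).toNNReal P := fun P hP =>
    h.sum_expectation_eq (v' := fun _ : Fin m => (σ ^ 2).toNNReal) (c' := fun _ => 1)
      (y' := fun i : Fin m => (i : ℝ)) hmom hP
  have hcp : ∑ i, c i * h.expectation (y i) (v i) p < ε := (hexp p hpdeg).trans_lt hσp
  -- Off the ball around `j`, the function `f j` is dominated by `p`.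
  have hfle : ∀ (j : Fin m) (i : Fin k), h.expectation (y i) (v i) (f j) ≤
      B * (gaussianReal (y i) (v i)).real (Set.Icc ((j : ℝ) - 1 / 4) ((j : ℝ) + 1 / 4)) +
        (ρ ^ 2)⁻¹ * h.expectation (y i) (v i) p := by
    intro j i
    have hind : Integrable ((Set.Icc ((j : ℝ) - 1 / 4) ((j : ℝ) + 1 / 4)).indicator fun _ => B)
        (gaussianReal (y i) (v i)) := (integrable_const B).indicator measurableSet_Icc
    rw [mul_comm B, ← smul_eq_mul, ← integral_indicator_const B measurableSet_Icc,
      expectation_apply, expectation_apply, ← integral_const_mul,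
      ← integral_add hind ((h.integrable_eval _ _ p).const_mul _)]
    refine integral_mono (h.integrable_eval _ _ _)
      (hind.add ((h.integrable_eval _ _ p).const_mul _)) fun x => ?_
    by_cases hx : x ∈ Set.Icc ((j : ℝ) - 1 / 4) ((j : ℝ) + 1 / 4)
    · simp only [Set.indicator_of_mem hx]
      have := mul_nonneg (inv_nonneg.mpr (sq_nonneg ρ)) (hp0 (φ x))
      linarith [hfB j x hx]
    · simp only [Set.indicator_of_notMem hx, zero_add]
      have hfar : x ≤ j - 1 / 4 ∨ (j : ℝ) + 1 / 4 ≤ x := by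
        by_contra! hcon
        exact hx ⟨hcon.1.le, hcon.2.le⟩
      rw [hpf j, ← div_eq_inv_mul, le_div_iff₀ (pow_pos hρ 2), mul_comm]
      exact mul_le_mul_of_nonneg_right (hρφ j x hfar) (hf0 j _)
  have hple : ∀ (j : Fin m) (i : Fin k), (ρ ^ 2) ^ m *
      (gaussianReal (y i) (v i)).real (Set.Icc ((j : ℝ) + 1 / 4) ((j : ℝ) + 3 / 4)) ≤
        h.expectation (y i) (v i) p := by
    intro j i
    rw [mul_comm, ← smul_eq_mul, ← integral_indicator_const _ measurableSet_Icc,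
      expectation_apply]
    refine integral_mono ((integrable_const _).indicator measurableSet_Icc)
      (h.integrable_eval _ _ p) fun x => ?_
    by_cases hx : x ∈ Set.Icc ((j : ℝ) + 1 / 4) ((j : ℝ) + 3 / 4)
    · simp only [Set.indicator_of_mem hx]
      rw [hpeval]
      have hprod : ∏ _i : Fin m, ρ ^ 2 ≤ ∏ i : Fin m, (φ x - φ i) ^ 2 := by
        refine Finset.prod_le_prod (fun _ _ => sq_nonneg ρ) fun i _ => hρφ i x ?_
        rcases le_or_gt i j with hij | hij
        · have : (i : ℝ) ≤ j := by exact_mod_cast hij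
          exact Or.inr (by linarith [hx.1])
        · have : (j : ℝ) + 1 ≤ i := by exact_mod_cast hij
          exact Or.inl (by linarith [hx.2])
      simpa using hprod
    · simp only [Set.indicator_of_notMem hx]
      exact hp0 _
  have hheavy : ∀ j : Fin m, m * δ ≤ ∑ i, c i *
      (gaussianReal (y i) (v i)).real (Set.Icc ((j : ℝ) - 1 / 4) ((j : ℝ) + 1 / 4)) := by
    intro j
    have h1 : a / 2 < ∑ i, c i * h.expectation (y i) (v i) (f j) := by
      rw [hexp _ (hfdeg j)]
      refine (hσf j).trans_le ?_
      rw [← one_mul (h.expectation j _ _)]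
      exact Finset.single_le_sum
        (f := fun i : Fin m => 1 * h.expectation i (σ ^ 2).toNNReal (f j))
        (fun i _ => mul_nonneg zero_le_one (h.expectation_nonneg _ _ (hf0 j)))
        (Finset.mem_univ j)
    have h2 := Finset.sum_le_sum fun (i : Fin k) (_ : i ∈ Finset.univ) =>
      mul_le_mul_of_nonneg_left (hfle j i) (hc i)
    simp_rw [mul_add, mul_left_comm (c _), Finset.sum_add_distrib, ← Finset.mul_sum] at h2
    have h3 : (ρ ^ 2)⁻¹ * ∑ i, c i * h.expectation (y i) (v i) p ≤ a / 4 := by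
      rw [← div_eq_inv_mul, div_le_iff₀ (pow_pos hρ 2)]
      have := hcp.le.trans (min_le_left _ _)
      linarith
    have h4 : B * (m * δ) = a / 4 := by
      rw [hδdef]
      field_simp
    exact le_of_mul_le_mul_left (by linarith) hB
  obtain ⟨j, i, hji⟩ := exists_gap_le_of_heavy hk hc y hv hδ hheavy
  have h1 : (ρ ^ 2) ^ m * δ ≤ c i * h.expectation (y i) (v i) p := by
    have := mul_le_mul_of_nonneg_left hji (pow_nonneg (sq_nonneg ρ) m)
    have := mul_le_mul_of_nonneg_left (hple j i) (hc i)
    linarith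
  have h2 := Finset.single_le_sum (f := fun i => c i * h.expectation (y i) (v i) p)
    (fun i _ => mul_nonneg (hc i) (h.expectation_nonneg _ _ hp0)) (Finset.mem_univ i)
  have h3 := min_le_right (a * ρ ^ 2 / 4) ((ρ ^ 2) ^ m * δ)
  linarith

end IsGaussianCoordinate

/-! ### The mixture Carathéodory number -/

theorem IsGaussianCoordinate.mixtureCaratheodoryNumber_bounds {φ : ℝ → ℝ}
    (h : IsGaussianCoordinate φ) (d : ℕ) :
    ((d / 2 : ℕ) : ℕ∞) ≤ mixtureCaratheodoryNumber (monomialBasis d) (gaussianImageFamily φ) ∧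
      mixtureCaratheodoryNumber (monomialBasis d) (gaussianImageFamily φ) ≤
        ((d / 2 + 1 : ℕ) : ℕ∞) := by
  constructor
  · obtain ⟨s, hs, hlow⟩ := h.exists_not_hasMixtureRepresentation (d := d) (m := d / 2) (by omega)
    refine le_iSup₂_of_le s hs (Nat.cast_le.mpr ?_)
    by_contra! hlt
    exact hlow _ hlt (Nat.sInf_mem hs)
  · refine iSup₂_le fun s hs => Nat.cast_le.mpr ?_
    obtain ⟨k, hk, hrep⟩ := h.exists_hasMixtureRepresentation_le (n := d / 2 + 1) (by omega) hs
    exact (Nat.sInf_le hrep).trans hk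

/-- The mixture Carathéodory number does not depend on the parametrization of the family. -/
theorem mixtureCaratheodoryNumber_reparam {X S Ξ Ξ' ι : Type*} [MeasurableSpace X]
    (a : ι → X → ℝ) (δ : S → Ξ → Measure X) (e : Ξ' ≃ Ξ) :
    mixtureCaratheodoryNumber a (fun σ ξ => δ σ (e ξ)) = mixtureCaratheodoryNumber a δ := by
  have hrep : ∀ s k, HasMixtureRepresentation a (fun σ ξ => δ σ (e ξ)) s k ↔
      HasMixtureRepresentation a δ s k := by
    intro s k
    constructor
    · rintro ⟨c, σ, ξ, hc, hr⟩
      exact ⟨c, σ, fun i => e (ξ i), hc, hr⟩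
    · rintro ⟨c, σ, ξ, hc, hr⟩
      refine ⟨c, σ, fun i => e.symm (ξ i), hc, ?_⟩
      simpa [mixture] using hr
  simp only [mixtureCaratheodoryNumber, mixtureCone, mixtureCaratheodoryNumberOf, hrep]

theorem gaussianFamily_eq : gaussianFamily = gaussianImageFamily (fun x => x) := by
  funext σ y
  exact Measure.map_id'.symm

theorem logNormalFamily_eq :
    logNormalFamily = fun σ ξ =>
      gaussianImageFamily Real.exp σ (Real.expOrderIso.symm.toEquiv ξ) := by
  funext σ ξ
  have : Real.expOrderIso.symm.toEquiv ξ = Real.log ξ := by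
    refine Real.expOrderIso.symm_apply_eq.mpr ?_
    exact Subtype.ext (by rw [Real.coe_expOrderIso_apply, Real.exp_log ξ.2])
  rw [logNormalFamily, gaussianImageFamily, this]

theorem mainTheorem4 (d : ℕ) (hd : 1 ≤ d) :
    (((d / 2 : ℕ) : ℕ∞) ≤ mixtureCaratheodoryNumber (monomialBasis d) gaussianFamily ∧
      mixtureCaratheodoryNumber (monomialBasis d) gaussianFamily ≤ ((d / 2 + 1 : ℕ) : ℕ∞)) ∧
    (((d / 2 : ℕ) : ℕ∞) ≤ mixtureCaratheodoryNumber (monomialBasis d) logNormalFamily ∧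
      mixtureCaratheodoryNumber (monomialBasis d) logNormalFamily ≤ ((d / 2 + 1 : ℕ) : ℕ∞)) := by
  rw [gaussianFamily_eq, logNormalFamily_eq,
    mixtureCaratheodoryNumber_reparam _ _ Real.expOrderIso.symm.toEquiv]
  exact ⟨IsGaussianCoordinate.id.mixtureCaratheodoryNumber_bounds d,
    IsGaussianCoordinate.exp.mixtureCaratheodoryNumber_bounds d⟩
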